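/- Let $0<\rho<1$ and let $\alpha,h$ be real, with $h\neq 4(1+\rho^2)\left(m+\tfrac52\right)^2$ for all integers $m\ge 0$. Write $(x)_n=x(x+1)\cdots(x+n-1)$, let $\sqrt{\cdot}$ be the principal complex square root, and for $k\ge 0$ put $$\Delta_k^{\pm}=2k+\tfrac12\pm\sqrt{\frac{h}{4(1+\rho^2)}} ,\qquad \eta=(1+\rho^2)\,\xi,\qquad z=-\rho^2\xi^2 ,$$ $$w_k(i)=\frac{\left(i+2k+\frac{\alpha}{2}+1\right)\left(i+2k-\frac{\alpha}{2}+\frac12\right)}{\left(i+2k+\frac52\right)(i+2k+2)},\qquad r_k(j,i)=\frac{(\Delta_k^-)_i\,(\Delta_k^+)_i\,\left(2k+\frac32\right)_j(2k+1)_j}{(\Delta_k^-)_j\,(\Delta_k^+)_j\,\left(2k+\frac32\right)_i(2k+1)_i}.$$ (so $r_0(0,i)=\frac{(\Delta_0^-)_i(\Delta_0^+)_i}{(3/2)_i(1)_i}$). Define $$LS^R(\xi)=\xi^{1/2}\,g(\xi),\qquad g(\xi)=\sum_{n=0}^{\infty}Y_n(\eta)\,z^n,$$ $$Y_n(\eta)=\sum_{i_0=0}^{\infty}w_0(i_0)\,r_0(0,i_0)\sum_{i_1=i_0}^{\infty}w_1(i_1)\,r_1(i_0,i_1)\cdots\sum_{i_{n-1}=i_{n-2}}^{\infty}w_{n-1}(i_{n-1})\,r_{n-1}(i_{n-2},i_{n-1})\sum_{i_n=i_{n-1}}^{\infty}r_n(i_{n-1},i_n)\,\eta^{i_n},$$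 where $Y_0(\eta)=\sum_{i_0\ge0}r_0(0,i_0)\eta^{i_0}$ and $\xi^{1/2}$ is the principal branch. Let $D=\{\xi\in\mathbb C: |\eta|+|z|<1\}$, a disc about $0$. Then: 1. No factor $(\Delta_k^{\pm})_i$ with $k\ge1$, $i\ge0$ vanishes, so that all terms are defined, and for $\xi\in D$ all the nested sums and the sum over $n$ converge (absolutely). 2. $g$ is holomorphic in $D$ and $g(0)=1$; thus $LS^R$ belongs to the exponent $\tfrac12$ at $\xi=0$, with leading coefficient $1$. 3. $LS^R$ is holomorphic in $D\setminus(-\infty,0]$ and there $y=LS^R$ satisfies Lamé's equation $$\frac{d^2y}{d\xi^2}+\frac12\left(\frac1\xi+\frac1{\xi-1}+\frac1{\xi-\rho^{-2}}\right)\frac{dy}{d\xi}+\frac{-\alpha(\alpha+1)\xi+h\rho^{-2}}{4\xi(\xi-1)(\xi-\rho^{-2})}\,y=0 .$$ 4. With the Jacobi elliptic function $\mathrm{sn}(u,\rho)$, the function $y(u)=LS^R(\mathrm{sn}^2(u,\rho))$ is twice differentiable and satisfies Lamé's equation in Weierstrass's form $$\frac{d^2y}{du^2}=\left\{\alpha(\alpha+1)\rho^2\,\mathrm{sn}^2(u,\rho)-h\right\}y$$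 at every real $u$ with $\mathrm{sn}(u,\rho)\ne0$ and $\mathrm{sn}^2(u,\rho)\in D$. -/

import Mathlib

open scoped Real

noncomputable section

namespace Lame

/-- The incomplete elliptic integral of the first kind with modulus `ρ`. -/
def ellipticF (ρ φ : ℝ) : ℝ :=
  ∫ θ in (0 : ℝ)..φ, 1 / √(1 - ρ ^ 2 * Real.sin θ ^ 2)

/-- The Jacobi amplitude, the inverse function of `φ ↦ ellipticF ρ φ`
(a bijection of `ℝ` for `0 < ρ < 1`). -/
def am (ρ : ℝ) : ℝ → ℝ :=
  Function.invFun (ellipticF ρ)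

/-- The Jacobi elliptic function `sn(u, ρ)` of a real argument. -/
def sn (ρ u : ℝ) : ℝ :=
  Real.sin (am ρ u)

/-- The rising factorial `(x)_n = x (x + 1) ⋯ (x + n - 1)`. -/
def poch (x : ℂ) (n : ℕ) : ℂ :=
  (ascPochhammer ℂ n).eval x

/-- `√(h / (4 (1 + ρ²)))`, the principal square root; it is imaginary for `h < 0`. -/
def root (ρ h : ℝ) : ℂ :=
  ((h : ℂ) / (4 * (1 + (ρ : ℂ) ^ 2))) ^ (1 / 2 : ℂ)

/-- `Δ_k⁻ = 2k + 1/2 - √(h / (4 (1 + ρ²)))`. -/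
def deltaMinus (ρ h : ℝ) (k : ℕ) : ℂ :=
  2 * k + 1 / 2 - root ρ h

/-- `Δ_k⁺ = 2k + 1/2 + √(h / (4 (1 + ρ²)))`. -/
def deltaPlus (ρ h : ℝ) (k : ℕ) : ℂ :=
  2 * k + 1 / 2 + root ρ h

/-- The quotient of rising factorials at level `k`, with `i = i_k` and `j = i_{k-1}`.
For `k = 0` it is used with `j = 0`, where it is
`(Δ_0⁻)_i (Δ_0⁺)_i / ((3/2)_i (1)_i)`. -/
def ratio (ρ h : ℝ) (k j i : ℕ) : ℂ :=
  (poch (deltaMinus ρ h k) i * poch (deltaPlus ρ h k) i *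
      poch (2 * k + 3 / 2) j * poch (2 * k + 1) j) /
    (poch (deltaMinus ρ h k) j * poch (deltaPlus ρ h k) j *
      poch (2 * k + 3 / 2) i * poch (2 * k + 1) i)

/-- The rational factor at level `k`, with `i = i_k`. -/
def weight (α : ℝ) (k i : ℕ) : ℂ :=
  ((i + 2 * k + (α : ℂ) / 2 + 1) * (i + 2 * k - (α : ℂ) / 2 + 1 / 2)) /
    ((i + 2 * k + 5 / 2) * (i + 2 * k + 2))

/-- The summand, at the value `i` of the index `i_k`, of the sum over `i_k ≥ i_{k-1} = j` at
level `k` of the nested series, when `m` further sums (over `i_{k+1}, …, i_{k+m}`) are nested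
inside it. -/
def summand (ρ α h : ℝ) (η : ℂ) : (m k j i : ℕ) → ℂ
  | 0, k, j, i => ratio ρ h k j i * η ^ i
  | m + 1, k, j, i =>
      weight α k i * ratio ρ h k j i *
        ∑' i' : Set.Ici i, summand ρ α h η m (k + 1) i i'

/-- The factor of `z ^ n`: the `(n + 1)`-fold nested sum over `0 ≤ i_0 ≤ i_1 ≤ ⋯ ≤ i_n`. -/
def nested (ρ α h : ℝ) (η : ℂ) (n : ℕ) : ℂ :=
  ∑' i : Set.Ici (0 : ℕ), summand ρ α h η n 0 0 i

/-- `η = (1 + ρ²) ξ`. -/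
def eta (ρ : ℝ) (ξ : ℂ) : ℂ :=
  (1 + (ρ : ℂ) ^ 2) * ξ

/-- `z = -ρ² ξ²`. -/
def zeta (ρ : ℝ) (ξ : ℂ) : ℂ :=
  -(ρ : ℂ) ^ 2 * ξ ^ 2

/-- The series in braces, without the factor `ξ^{1/2}`. -/
def bracket (ρ α h : ℝ) (ξ : ℂ) : ℂ :=
  ∑' n : ℕ, nested ρ α h (eta ρ ξ) n * zeta ρ ξ ^ n

/-- The function of the second kind `LS^R(ρ, α, h; ξ)`, with the principal branch of
`ξ^{1/2}`. -/
def LS (ρ α h : ℝ) (ξ : ℂ) : ℂ :=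
  ξ ^ (1 / 2 : ℂ) * bracket ρ α h ξ

/-- The disc about `0` on which `|η| + |z| < 1`. -/
def disc (ρ : ℝ) : Set ℂ :=
  {ξ | ‖eta ρ ξ‖ + ‖zeta ρ ξ‖ < 1}

end Lame

end

/-! Substitute `N = i_k + 2k`. Then `r_k(j, j + i)` telescopes to a product of `i` consecutive
values of one sequence `A` starting at `j + 2k`, and `w_k(i)` is the value of one sequence `w` at `i
+ 2k`; neither sequence depends on `k` any longer. The nested series becomes a sum over lattice
paths from `0`, with single steps `n → n + 1` of weight `A n * η` and double steps `n → n + 2` of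
weight `w n * z`, grouped by the number of double steps (`tsum_summand_eq`).

Grouping the same paths by endpoint gives the three-term recurrence `pathSeq`, which is the
Frobenius recurrence of Lamé's equation at the exponent `1/2` (`seriesCoeff_add_two`). The two
groupings agree (`hasSum_pathSeq`) without rearranging a multiple series: the sum `P N` over paths
from `N` satisfies a first-step relation, and iterating it expresses `P 0` as a partial sum of
`pathSeq` plus a remainder tending to `0`.

Convergence holds because `A` and `w` tend to `1`: up to a factor `q` close to `1` and a bounded
correction, the sums are dominated by geometric series as soon as `‖η‖ + ‖z‖ < 1`. The differential
operator applied to a partial sum of the power series leaves only boundary terms, which vanish in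
the limit. Finally `x = sn²` satisfies `x'² = 4x(1 - x)(1 - ρ²x)`, and `x'²` and `x''` are exactly
the coefficients of the cleared equation in `ξ`, so the chain rule gives Weierstrass's form. -/

noncomputable section

namespace Lame

open Filter Topology Finset

/-! ### Lattice path sums and their recurrence -/

/-- The product `A N * A (N + 1) * ⋯ * A (N + i - 1)`. -/
def pathProd (A : ℕ → ℂ) (N i : ℕ) : ℂ :=
  ∏ l ∈ range i, A (N + l)

/-- The nested sum of depth `m` started at the index `N`: it sums the products of coefficients
along the lattice paths from `N` with single steps `n → n + 1` of weight `A n * η` and exactly `m`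
double steps `n → n + 2` of weight `w n`. -/
def levelSum (A w : ℕ → ℂ) (η : ℂ) : ℕ → ℕ → ℂ
  | 0, N => ∑' i, pathProd A N i * η ^ i
  | m + 1, N => ∑' i, pathProd A N i * η ^ i * (w (N + i) * levelSum A w η m (N + i + 2))

/-- The solution of the three-term recurrence with coefficients `A n * η` and `w n * z`. -/
def pathSeq (A w : ℕ → ℂ) (η z : ℂ) : ℕ → ℂ
  | 0 => 1
  | 1 => A 0 * η
  | n + 2 => A (n + 1) * η * pathSeq A w η z (n + 1) + w n * z * pathSeq A w η z n

theorem pathProd_zero (A : ℕ → ℂ) (N : ℕ) : pathProd A N 0 = 1 := by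
  simp [pathProd]

theorem pathProd_succ (A : ℕ → ℂ) (N i : ℕ) :
    pathProd A N (i + 1) = pathProd A N i * A (N + i) := by
  simp [pathProd, prod_range_succ]

theorem pathProd_succ' (A : ℕ → ℂ) (N i : ℕ) :
    pathProd A N (i + 1) = A N * pathProd A (N + 1) i := by
  rw [pathProd, prod_range_succ', mul_comm, pathProd, add_zero]
  simp only [add_assoc, add_comm 1]

/-! ### Geometric majorants -/

/-- `E` controls the growth of products of the coefficients `A` and `w`, up to powers of `q`. -/
structure Majorizes (A w : ℕ → ℂ) (q : ℝ) (E : ℕ → ℝ) : Prop where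
  one_le_q : 1 ≤ q
  one_le : ∀ n, 1 ≤ E n
  le_zero : ∀ n, E n ≤ E 0
  single : ∀ n, ‖A n‖ * E (n + 1) ≤ q * E n
  double : ∀ n, ‖w n‖ * E (n + 2) ≤ q * E n

theorem eventually_norm_le {A : ℕ → ℂ} (hA : Tendsto A atTop (𝓝 1)) {q : ℝ} (hq : 1 < q) :
    ∀ᶠ n in atTop, ‖A n‖ ≤ q := by
  have h := hA.norm
  rw [norm_one] at h
  exact h.eventually (eventually_le_nhds hq)

theorem exists_stretch {x : ℝ} (hx : x < 1) : ∃ q : ℝ, 1 < q ∧ q * x < 1 := by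
  have h : Tendsto (fun q : ℝ => q * x) (𝓝[>] 1) (𝓝 (1 * x)) :=
    ((continuous_id.mul continuous_const).tendsto 1).mono_left nhdsWithin_le_nhds
  rw [one_mul] at h
  exact ((eventually_mem_nhdsWithin (a := (1 : ℝ))).and (h.eventually (gt_mem_nhds hx))).exists

/-- From some `K` on both coefficients are at most `q` in norm; before that they are at most some `M
≥ 1`. The weight `M ^ (K - n)`, with truncated subtraction, pays one factor `M` for each index still
below `K` and is constantly `1` afterwards. -/
theorem exists_majorizes {A w : ℕ → ℂ} (hA : Tendsto A atTop (𝓝 1)) (hw : Tendsto w atTop (𝓝 1))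
    {q : ℝ} (hq : 1 < q) : ∃ E, Majorizes A w q E := by
  obtain ⟨K, hK⟩ := eventually_atTop.1
    ((eventually_norm_le hA hq).and (eventually_norm_le hw hq))
  obtain ⟨a, ha⟩ := hA.norm.bddAbove_range
  obtain ⟨b, hb⟩ := hw.norm.bddAbove_range
  set M := max 1 (max a b) with hM
  have hM1 : 1 ≤ M := le_max_left _ _
  have haM : ∀ n, ‖A n‖ ≤ M := fun n =>
    (ha ⟨n, rfl⟩).trans ((le_max_left _ _).trans (le_max_right _ _))
  have hbM : ∀ n, ‖w n‖ ≤ M := fun n =>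
    (hb ⟨n, rfl⟩).trans ((le_max_right _ _).trans (le_max_right _ _))
  have key : ∀ (x : ℕ → ℂ), (∀ n, ‖x n‖ ≤ M) → (∀ n ≥ K, ‖x n‖ ≤ q) → ∀ n,
      ‖x n‖ * M ^ (K - (n + 1)) ≤ q * M ^ (K - n) := by
    intro x h1 h2 n
    rcases lt_or_ge n K with h | h
    · have : K - n = (K - (n + 1)) + 1 := by omega
      rw [this, pow_succ]
      have h3 : 0 ≤ M ^ (K - (n + 1)) := by positivity
      calc ‖x n‖ * M ^ (K - (n + 1)) ≤ M * M ^ (K - (n + 1)) := by gcongr; exact h1 n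
        _ = 1 * (M ^ (K - (n + 1)) * M) := by ring
        _ ≤ q * (M ^ (K - (n + 1)) * M) := by gcongr
    · have e1 : K - n = 0 := by omega
      have e2 : K - (n + 1) = 0 := by omega
      rw [e1, e2]
      simpa using h2 n h
  refine ⟨fun n => M ^ (K - n), hq.le, fun n => one_le_pow₀ hM1, fun n =>
    pow_le_pow_right₀ hM1 (by omega), key A haM (fun n hn => (hK n hn).1), fun n => ?_⟩
  -- The weight is nonincreasing, so the bound across one index implies the bound across two.
  refine le_trans ?_ (key w hbM (fun n hn => (hK n hn).2) n)
  gcongr ?_ * ?_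
  exact pow_le_pow_right₀ hM1 (by omega)

section Bounds

variable {A w : ℕ → ℂ} {q : ℝ} {E : ℕ → ℝ} {η z : ℂ}

theorem Majorizes.pathProd_le (hE : Majorizes A w q E) (N i : ℕ) :
    ‖pathProd A N i‖ * E (N + i) ≤ q ^ i * E N := by
  have hq := hE.one_le_q
  induction i with
  | zero => simp [pathProd_zero]
  | succ i ih =>
    rw [pathProd_succ, norm_mul, pow_succ]
    calc ‖pathProd A N i‖ * ‖A (N + i)‖ * E (N + (i + 1))
        = ‖pathProd A N i‖ * (‖A (N + i)‖ * E (N + i + 1)) := by rw [mul_assoc, add_assoc]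
      _ ≤ ‖pathProd A N i‖ * (q * E (N + i)) := 
        mul_le_mul_of_nonneg_left (hE.single _) (norm_nonneg _)
      _ = q * (‖pathProd A N i‖ * E (N + i)) := by ring
      _ ≤ q * (q ^ i * E N) := by gcongr
      _ = _ := by ring

theorem Majorizes.norm_pathProd_le (hE : Majorizes A w q E) (N i : ℕ) :
    ‖pathProd A N i‖ ≤ q ^ i * E N :=
  (le_mul_of_one_le_right (norm_nonneg _) (hE.one_le _)).trans (hE.pathProd_le N i)

/-- The general term of a sum at depth `m + 1`, bounded through a bound at depth `m`. -/
theorem Majorizes.norm_step_le (hE : Majorizes A w q E) {B : ℝ} (hB : 0 ≤ B) {t : ℕ → ℂ}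
    (ht : ∀ N, ‖t N‖ ≤ E N * B) (N i : ℕ) :
    ‖pathProd A N i * η ^ i * (w (N + i) * t (N + i + 2))‖ ≤ E N * (q * B) * (q * ‖η‖) ^ i := by
  have hq := hE.one_le_q
  simp only [norm_mul, norm_pow]
  calc ‖pathProd A N i‖ * ‖η‖ ^ i * (‖w (N + i)‖ * ‖t (N + i + 2)‖)
      ≤ ‖pathProd A N i‖ * ‖η‖ ^ i * (‖w (N + i)‖ * (E (N + i + 2) * B)) := by
        gcongr; exact ht _
    _ = ‖pathProd A N i‖ * ‖η‖ ^ i * B * (‖w (N + i)‖ * E (N + i + 2)) := by ring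
    _ ≤ ‖pathProd A N i‖ * ‖η‖ ^ i * B * (q * E (N + i)) := 
        mul_le_mul_of_nonneg_left (hE.double _) (by positivity)
    _ = ‖pathProd A N i‖ * E (N + i) * (‖η‖ ^ i * B * q) := by ring
    _ ≤ q ^ i * E N * (‖η‖ ^ i * B * q) := 
        mul_le_mul_of_nonneg_right (hE.pathProd_le N i) (by positivity)
    _ = _ := by rw [mul_pow]; ring

theorem Majorizes.norm_base_le (hE : Majorizes A w q E) (N i : ℕ) :
    ‖pathProd A N i * η ^ i‖ ≤ E N * (q * ‖η‖) ^ i := by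
  rw [norm_mul, norm_pow, mul_pow]
  calc ‖pathProd A N i‖ * ‖η‖ ^ i ≤ q ^ i * E N * ‖η‖ ^ i := by
        gcongr; exact hE.norm_pathProd_le N i
    _ = _ := by ring

/-- Each run of single steps costs a geometric series in `q * ‖η‖` and each double step a factor
`q`. The weight `E` is carried along the path, so the early exceptional coefficients are paid for
only once and not once per level. -/
theorem Majorizes.norm_levelSum_le (hE : Majorizes A w q E) (hη : q * ‖η‖ < 1) (m N : ℕ) :
    ‖levelSum A w η m N‖ ≤ E N * ((1 - q * ‖η‖)⁻¹ * (q * (1 - q * ‖η‖)⁻¹) ^ m) := by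
  have hq := hE.one_le_q
  have h0 : 0 ≤ q * ‖η‖ := by positivity
  have hR : 0 ≤ (1 - q * ‖η‖)⁻¹ := inv_nonneg.2 (by linarith)
  have hgeo := hasSum_geometric_of_lt_one h0 hη
  induction m generalizing N with
  | zero =>
    rw [levelSum, pow_zero, mul_one]
    exact tsum_of_norm_bounded (hgeo.mul_left (E N)) (hE.norm_base_le N)
  | succ m ih =>
    rw [levelSum]
    refine (tsum_of_norm_bounded (hgeo.mul_left _)
      (hE.norm_step_le (by positivity) ih N)).trans_eq ?_
    ring

theorem Majorizes.summable_base (hE : Majorizes A w q E) (hη : q * ‖η‖ < 1) (N : ℕ) :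
    Summable fun i => pathProd A N i * η ^ i := by
  have hq := hE.one_le_q
  exact .of_norm_bounded ((summable_geometric_of_lt_one (by positivity) hη).mul_left _)
    (hE.norm_base_le N)

theorem Majorizes.summable_step (hE : Majorizes A w q E) (hη : q * ‖η‖ < 1) (m N : ℕ) :
    Summable fun i => pathProd A N i * η ^ i * (w (N + i) * levelSum A w η m (N + i + 2)) := by
  have hq := hE.one_le_q
  have hR : 0 ≤ (1 - q * ‖η‖)⁻¹ := inv_nonneg.2 (by linarith)
  exact .of_norm_bounded ((summable_geometric_of_lt_one (by positivity) hη).mul_left _)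
    (hE.norm_step_le (by positivity) (hE.norm_levelSum_le hη m) N)

theorem Majorizes.levelSum_zero_eq (hE : Majorizes A w q E) (hη : q * ‖η‖ < 1) (N : ℕ) :
    levelSum A w η 0 N = 1 + A N * η * levelSum A w η 0 (N + 1) := by
  rw [levelSum, (hE.summable_base hη N).tsum_eq_zero_add, levelSum, ← tsum_mul_left]
  congr 1
  · simp [pathProd_zero]
  · refine tsum_congr fun i => ?_
    rw [pathProd_succ']
    ring

theorem Majorizes.levelSum_succ_eq (hE : Majorizes A w q E) (hη : q * ‖η‖ < 1) (m N : ℕ) :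
    levelSum A w η (m + 1) N =
      w N * levelSum A w η m (N + 2) + A N * η * levelSum A w η (m + 1) (N + 1) := by
  rw [levelSum, (hE.summable_step hη m N).tsum_eq_zero_add, levelSum, ← tsum_mul_left]
  congr 1
  · simp [pathProd_zero]
  · refine tsum_congr fun i => ?_
    rw [pathProd_succ', show N + (i + 1) = N + 1 + i by ring]
    ring

theorem Majorizes.norm_term_le (hE : Majorizes A w q E) (hη : q * ‖η‖ < 1) (N m : ℕ) :
    ‖levelSum A w η m N * z ^ m‖ ≤
      E 0 * (1 - q * ‖η‖)⁻¹ * (q * ‖z‖ * (1 - q * ‖η‖)⁻¹) ^ m := by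
  have hq := hE.one_le_q
  have hR : 0 ≤ (1 - q * ‖η‖)⁻¹ := inv_nonneg.2 (by linarith)
  rw [norm_mul, norm_pow]
  calc ‖levelSum A w η m N‖ * ‖z‖ ^ m
      ≤ E N * ((1 - q * ‖η‖)⁻¹ * (q * (1 - q * ‖η‖)⁻¹) ^ m) * ‖z‖ ^ m := by
        gcongr; exact hE.norm_levelSum_le hη m N
    _ ≤ E 0 * ((1 - q * ‖η‖)⁻¹ * (q * (1 - q * ‖η‖)⁻¹) ^ m) * ‖z‖ ^ m := by
        gcongr; exact hE.le_zero N
    _ = _ := by simp only [mul_pow]; ring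

theorem ratio_lt_one (hqz : q * (‖η‖ + ‖z‖) < 1) (hη : q * ‖η‖ < 1) :
    q * ‖z‖ * (1 - q * ‖η‖)⁻¹ < 1 := by
  rw [← div_eq_mul_inv, div_lt_one (by linarith)]
  linarith

theorem Majorizes.summable_term (hE : Majorizes A w q E) (hqz : q * (‖η‖ + ‖z‖) < 1)
    (hη : q * ‖η‖ < 1) (N : ℕ) : Summable fun m => levelSum A w η m N * z ^ m := by
  have hq := hE.one_le_q
  have hR : 0 ≤ (1 - q * ‖η‖)⁻¹ := inv_nonneg.2 (by linarith)
  exact .of_norm_bounded ((summable_geometric_of_lt_one (by positivity)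
    (ratio_lt_one hqz hη)).mul_left _) (hE.norm_term_le hη N)

theorem Majorizes.exists_norm_tsum_le (hE : Majorizes A w q E) (hqz : q * (‖η‖ + ‖z‖) < 1)
    (hη : q * ‖η‖ < 1) : ∃ C, ∀ N, ‖∑' m, levelSum A w η m N * z ^ m‖ ≤ C := by
  have hq := hE.one_le_q
  have hR : 0 ≤ (1 - q * ‖η‖)⁻¹ := inv_nonneg.2 (by linarith)
  exact ⟨_, fun N => tsum_of_norm_bounded ((hasSum_geometric_of_lt_one (by positivity)
    (ratio_lt_one hqz hη)).mul_left _) (hE.norm_term_le hη N)⟩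

/-- The decomposition of the path sum from `N` by the first step of the path. -/
theorem Majorizes.tsum_levelSum_eq (hE : Majorizes A w q E) (hqz : q * (‖η‖ + ‖z‖) < 1)
    (hη : q * ‖η‖ < 1) (N : ℕ) :
    ∑' m, levelSum A w η m N * z ^ m =
      1 + A N * η * ∑' m, levelSum A w η m (N + 1) * z ^ m +
        w N * z * ∑' m, levelSum A w η m (N + 2) * z ^ m := by
  have h1 := hE.summable_term hqz hη (N + 1)
  have h2 := hE.summable_term hqz hη (N + 2)
  have h1' := (summable_nat_add_iff 1).2 h1
  rw [(hE.summable_term hqz hη N).tsum_eq_zero_add, h1.tsum_eq_zero_add, mul_add,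
    ← tsum_mul_left, ← tsum_mul_left, hE.levelSum_zero_eq hη N]
  have : ∑' m, levelSum A w η (m + 1) N * z ^ (m + 1) =
      ∑' m, (A N * η * (levelSum A w η (m + 1) (N + 1) * z ^ (m + 1)) +
        w N * z * (levelSum A w η m (N + 2) * z ^ m)) := by
    refine tsum_congr fun m => ?_
    rw [hE.levelSum_succ_eq hη m N]
    ring
  rw [this, (h1'.mul_left _).tsum_add (h2.mul_left _)]
  ring

/-- Eventually each term is at most `κ < 1` times the larger of the bounds for the two preceding
ones. This gains a factor `κ` every two indices, hence the rate `θ = √κ`; the constant `C` absorbs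
the initial terms. -/
theorem exists_norm_pathSeq_le (hA : Tendsto A atTop (𝓝 1)) (hw : Tendsto w atTop (𝓝 1))
    (hz : ‖η‖ + ‖z‖ < 1) :
    ∃ C θ : ℝ, 0 < θ ∧ θ < 1 ∧ ∀ n, ‖pathSeq A w η z n‖ ≤ C * θ ^ n := by
  obtain ⟨q, hq, hqz⟩ := exists_stretch hz
  obtain ⟨K, hK⟩ := eventually_atTop.1
    ((eventually_norm_le hA hq).and (eventually_norm_le hw hq))
  -- The maximum with `0` makes `κ`, and so `θ`, positive even when `η = z = 0`.
  obtain ⟨κ, hκ, hκ1⟩ := exists_between (max_lt hqz one_pos)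
  have hκ0 : 0 < κ := (le_max_right _ _).trans_lt hκ
  have hκq : q * (‖η‖ + ‖z‖) ≤ κ := ((le_max_left _ _).trans_lt hκ).le
  set θ := √κ with hθ
  have hθ0 : 0 < θ := Real.sqrt_pos.2 hκ0
  have hθ1 : θ < 1 := by rw [hθ, Real.sqrt_lt' one_pos]; simpa using hκ1
  have hθ2 : θ ^ 2 = κ := Real.sq_sqrt hκ0.le
  set s := pathSeq A w η z
  set C := ∑ n ∈ range (K + 2), ‖s n‖ / θ ^ n with hC
  have hC0 : 0 ≤ C := sum_nonneg fun n _ => by positivity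
  have hsmall : ∀ n < K + 2, ‖s n‖ ≤ C * θ ^ n := by
    intro n hn
    rw [← div_le_iff₀ (by positivity)]
    exact single_le_sum (f := fun n => ‖s n‖ / θ ^ n) (fun n _ => by positivity)
      (mem_range.2 hn)
  refine ⟨C, θ, hθ0, hθ1, fun n => ?_⟩
  induction n using Nat.strong_induction_on with
  | _ n ih =>
    rcases lt_or_ge n (K + 2) with h | h
    · exact hsmall n h
    · obtain ⟨n, rfl⟩ : ∃ p, n = p + 2 := ⟨n - 2, by omega⟩
      have e1 : ‖A (n + 1)‖ ≤ q := (hK (n + 1) (by omega)).1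
      have e2 : ‖w n‖ ≤ q := (hK n (by omega)).2
      have i1 : ‖s (n + 1)‖ ≤ C * θ ^ n := (ih (n + 1) (by omega)).trans
        (mul_le_mul_of_nonneg_left (pow_le_pow_of_le_one hθ0.le hθ1.le (by omega)) hC0)
      have i2 : ‖s n‖ ≤ C * θ ^ n := ih n (by omega)
      calc ‖s (n + 2)‖ ≤ ‖A (n + 1)‖ * ‖η‖ * ‖s (n + 1)‖ + ‖w n‖ * ‖z‖ * ‖s n‖ := by
            refine (norm_add_le _ _).trans_eq ?_
            simp only [norm_mul]; rfl
        _ ≤ q * ‖η‖ * (C * θ ^ n) + q * ‖z‖ * (C * θ ^ n) := by gcongr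
        _ = q * (‖η‖ + ‖z‖) * (C * θ ^ n) := by ring
        _ ≤ κ * (C * θ ^ n) := by gcongr
        _ = C * θ ^ (n + 2) := by rw [pow_add, hθ2]; ring

end Bounds

/-! ### The two groupings of the path sum -/

theorem exists_majorizes_stretch {A w : ℕ → ℂ} {η z : ℂ} (hA : Tendsto A atTop (𝓝 1))
    (hw : Tendsto w atTop (𝓝 1)) (hz : ‖η‖ + ‖z‖ < 1) :
    ∃ q E, Majorizes A w q E ∧ q * (‖η‖ + ‖z‖) < 1 ∧ q * ‖η‖ < 1 := by
  obtain ⟨q, hq, hqz⟩ := exists_stretch hz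
  obtain ⟨E, hE⟩ := exists_majorizes hA hw hq
  refine ⟨q, E, hE, hqz, ?_⟩
  have : 0 ≤ q * ‖z‖ := by positivity
  linarith

/-- The sum over all lattice paths from `0` is the sum of the solution of the recurrence. -/
theorem hasSum_pathSeq {A w : ℕ → ℂ} {η z : ℂ} (hA : Tendsto A atTop (𝓝 1))
    (hw : Tendsto w atTop (𝓝 1)) (hz : ‖η‖ + ‖z‖ < 1) :
    HasSum (pathSeq A w η z) (∑' m, levelSum A w η m 0 * z ^ m) := by
  obtain ⟨q, E, hE, hqz, hη⟩ := exists_majorizes_stretch hA hw hz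
  obtain ⟨C, θ, hθ0, hθ1, hs⟩ := exists_norm_pathSeq_le hA hw hz
  obtain ⟨D, hD⟩ := hE.exists_norm_tsum_le hqz hη
  set P : ℕ → ℂ := fun N => ∑' m, levelSum A w η m N * z ^ m with hP
  have hrec : ∀ N, P N = 1 + A N * η * P (N + 1) + w N * z * P (N + 2) :=
    hE.tsum_levelSum_eq hqz hη
  set s := pathSeq A w η z with hsdef
  have hs2 : ∀ n, s (n + 2) = A (n + 1) * η * s (n + 1) + w n * z * s n := fun n => rfl
  have hsum : Summable s := .of_norm_bounded
    ((summable_geometric_of_lt_one hθ0.le hθ1).mul_left C) hs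
  -- Paths are split at the first point where they pass beyond `n`: they arrive at `n + 1`, or jump
  -- over it from `n` to `n + 2`. Both remainders tend to `0` because `s` does and `P` is bounded
  -- uniformly in its starting point.
  have hpart : ∀ n, P 0 =
      ∑ i ∈ range (n + 1), s i + s (n + 1) * P (n + 1) + w n * z * s n * P (n + 2) := by
    intro n
    induction n with
    | zero =>
      rw [hrec 0]
      simp [hsdef, pathSeq]
    | succ n ih =>
      rw [ih, sum_range_succ _ (n + 1), hrec (n + 1), hs2 n]
      ring
  have hs0 : Tendsto s atTop (𝓝 0) := hsum.tendsto_atTop_zero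
  have hPb : IsBoundedUnder (· ≤ ·) atTop ((‖·‖) ∘ P) := isBoundedUnder_of ⟨D, hD⟩
  have hb1 : Tendsto (fun n => s (n + 1) * P (n + 1)) atTop (𝓝 0) :=
    (hs0.zero_mul_isBoundedUnder_le hPb).comp (tendsto_add_atTop_nat 1)
  have hwz : Tendsto (fun n => w n * z * s n) atTop (𝓝 0) := by
    simpa using (hw.mul_const z).mul hs0
  have hb2 : Tendsto (fun n => w n * z * s n * P (n + 2)) atTop (𝓝 0) :=
    hwz.zero_mul_isBoundedUnder_le (isBoundedUnder_of ⟨D, fun n => hD (n + 2)⟩)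
  have hlim : Tendsto (fun n => ∑ i ∈ range (n + 1), s i) atTop (𝓝 (P 0)) := by
    have h := (tendsto_const_nhds (x := P 0)).sub (hb1.add hb2)
    rw [add_zero, sub_zero] at h
    refine h.congr fun n => ?_
    rw [hpart n]
    ring
  have := tendsto_nhds_unique hlim ((tendsto_add_atTop_iff_nat 1).2 hsum.hasSum.tendsto_sum_nat)
  have hfin : HasSum s (P 0) := this ▸ hsum.hasSum
  exact hfin

/-- A path from `0` to `n` with `a` single and `b` double steps has `a + 2 * b = n`, so the powers
of `ξ` combine to `ξ ^ n`. -/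
theorem pathSeq_mul (A w : ℕ → ℂ) (e f ξ : ℂ) (n : ℕ) :
    pathSeq A w (e * ξ) (f * ξ ^ 2) n = pathSeq A w e f n * ξ ^ n := by
  induction n using Nat.strong_induction_on with
  | _ n ih =>
    match n with
    | 0 => simp [pathSeq]
    | 1 => simp [pathSeq, mul_assoc]
    | n + 2 =>
      rw [pathSeq, pathSeq, ih (n + 1) (by omega), ih n (by omega)]
      ring

/-! ### The nested series as a path sum -/

/-- The coefficient of the single step of the three-term recurrence, divided by `1 + ρ²`. -/
def singleCoeff (ρ h : ℝ) (n : ℕ) : ℂ :=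
  ((n + 1 / 2 - root ρ h) * (n + 1 / 2 + root ρ h)) / ((n + 3 / 2) * (n + 1))

/-- The coefficient of the double step of the three-term recurrence, divided by `-ρ²`. -/
def doubleCoeff (α : ℝ) (n : ℕ) : ℂ :=
  ((n + (α : ℂ) / 2 + 1) * (n - (α : ℂ) / 2 + 1 / 2)) / ((n + 5 / 2) * (n + 2))

theorem tendsto_natCast_add_div_add (c d : ℂ) :
    Tendsto (fun n : ℕ => ((n : ℂ) + c) / (n + d)) atTop (𝓝 1) := by
  have h := (tendsto_natCast_div_add_atTop d).div (tendsto_natCast_div_add_atTop c) one_ne_zero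
  rw [div_one] at h
  refine h.congr' ?_
  filter_upwards [eventually_gt_atTop 0] with n hn
  have hn' : (n : ℂ) ≠ 0 := by exact_mod_cast hn.ne'
  simp only [Pi.div_apply]
  rw [div_div_div_comm, div_self hn', one_div, inv_div]

theorem tendsto_singleCoeff (ρ h : ℝ) : Tendsto (singleCoeff ρ h) atTop (𝓝 1) := by
  have := (tendsto_natCast_add_div_add (1 / 2 - root ρ h) (3 / 2)).mul
    (tendsto_natCast_add_div_add (1 / 2 + root ρ h) 1)
  rw [one_mul] at this
  refine this.congr fun n => ?_
  rw [div_mul_div_comm, singleCoeff]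
  ring

theorem tendsto_doubleCoeff (α : ℝ) : Tendsto (doubleCoeff α) atTop (𝓝 1) := by
  have := (tendsto_natCast_add_div_add ((α : ℂ) / 2 + 1) (5 / 2)).mul
    (tendsto_natCast_add_div_add (-((α : ℂ) / 2) + 1 / 2) 2)
  rw [one_mul] at this
  refine this.congr fun n => ?_
  rw [div_mul_div_comm, doubleCoeff]
  ring

theorem root_sq (ρ h : ℝ) : root ρ h ^ 2 = (h : ℂ) / (4 * (1 + (ρ : ℂ) ^ 2)) := by
  rw [root, one_div]
  exact Complex.cpow_ofNat_inv_pow _ 2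

theorem one_add_sq_ne_zero (ρ : ℝ) : (1 + (ρ : ℂ) ^ 2) ≠ 0 := by
  have : (1 + ρ ^ 2 : ℝ) ≠ 0 := by positivity
  exact_mod_cast this

theorem poch_succ (x : ℂ) (n : ℕ) : poch x (n + 1) = poch x n * (x + n) := by
  rw [poch, ascPochhammer_succ_eval, poch]

theorem poch_zero (x : ℂ) : poch x 0 = 1 := by
  simp [poch]

theorem poch_ne_zero {x : ℂ} {n : ℕ} (hx : ∀ l : ℕ, x + l ≠ 0) : poch x n ≠ 0 := by
  induction n with
  | zero => simp [poch_zero]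
  | succ n ih => rw [poch_succ]; exact mul_ne_zero ih (hx n)

theorem root_sq_ne {ρ h : ℝ} (hh : ∀ m : ℕ, h ≠ 4 * (1 + ρ ^ 2) * ((m : ℝ) + 5 / 2) ^ 2) (m : ℕ) :
    root ρ h ^ 2 ≠ ((m : ℂ) + 5 / 2) ^ 2 := by
  intro h0
  have h1 := one_add_sq_ne_zero ρ
  rw [root_sq, div_eq_iff (by simpa using h1)] at h0
  apply hh m
  have : (h : ℂ) = ((4 * (1 + ρ ^ 2) * ((m : ℝ) + 5 / 2) ^ 2 : ℝ) : ℂ) := by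
    rw [h0]; push_cast; ring
  exact_mod_cast this

/-- For `k ≥ 1` a vanishing factor would force the root to be `±(m + 5/2)` with `m = 2(k - 1) + l`,
which the hypothesis on `h` excludes. -/
theorem poch_delta_ne_zero {ρ h : ℝ}
    (hh : ∀ m : ℕ, h ≠ 4 * (1 + ρ ^ 2) * ((m : ℝ) + 5 / 2) ^ 2) (k i : ℕ) (hk : 1 ≤ k) :
    poch (deltaMinus ρ h k) i ≠ 0 ∧ poch (deltaPlus ρ h k) i ≠ 0 := by
  obtain ⟨k, rfl⟩ := Nat.exists_eq_add_of_le' hk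
  constructor <;> refine poch_ne_zero fun l h0 => root_sq_ne hh (2 * k + l) ?_
  · have : root ρ h = 2 * k + l + 5 / 2 := by
      rw [deltaMinus] at h0; push_cast at h0; linear_combination -h0
    rw [this]; push_cast; ring
  · have : root ρ h = -(2 * k + l + 5 / 2) := by
      rw [deltaPlus] at h0; push_cast at h0; linear_combination h0
    rw [this]; push_cast; ring

theorem natCast_add_ne_zero {x : ℝ} (hx : 0 < x) (n : ℕ) : ((n : ℂ) + x) ≠ 0 := by
  have : ((n : ℝ) + x) ≠ 0 := by positivity
  exact_mod_cast this

theorem poch_natCast_add_ne_zero {x : ℝ} (hx : 0 < x) (k n : ℕ) :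
    poch (2 * k + x) n ≠ 0 := by
  refine poch_ne_zero fun l => ?_
  have := natCast_add_ne_zero hx (2 * k + l)
  push_cast at this
  convert this using 1
  ring

theorem ratio_eq_pathProd {ρ h : ℝ} {k j : ℕ} (h1 : poch (deltaMinus ρ h k) j ≠ 0)
    (h2 : poch (deltaPlus ρ h k) j ≠ 0) (i : ℕ) :
    ratio ρ h k j (j + i) = pathProd (singleCoeff ρ h) (j + 2 * k) i := by
  have h3 : poch (2 * k + 3 / 2) j ≠ 0 := by
    simpa using poch_natCast_add_ne_zero (x := 3 / 2) (by norm_num) k j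
  have h4 : poch (2 * k + 1) j ≠ 0 := by
    simpa using poch_natCast_add_ne_zero (x := 1) (by norm_num) k j
  induction i with
  | zero =>
    rw [pathProd_zero, ratio, add_zero]
    exact div_self (by positivity)
  | succ i ih =>
    rw [pathProd_succ, ← ih, ← add_assoc, ratio, ratio, singleCoeff, div_mul_div_comm]
    simp only [poch_succ, deltaMinus, deltaPlus]
    push_cast
    congr 1 <;> ring

/-- Division by zero has the value `0`. This matters only for `k = 0`, `j > 0`, which the nested
series never uses but the summability claim for all `k` and `j` includes. -/
theorem ratio_eq_zero {ρ h : ℝ} {k j : ℕ} (i : ℕ)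
    (h0 : ¬ (poch (deltaMinus ρ h k) j ≠ 0 ∧ poch (deltaPlus ρ h k) j ≠ 0)) :
    ratio ρ h k j i = 0 := by
  have : poch (deltaMinus ρ h k) j * poch (deltaPlus ρ h k) j = 0 := by
    rw [mul_eq_zero]; tauto
  rw [ratio, this]
  simp

theorem weight_eq_doubleCoeff (α : ℝ) (k i : ℕ) : weight α k i = doubleCoeff α (i + 2 * k) := by
  rw [weight, doubleCoeff]
  push_cast
  rfl

/-- The shift `i ↦ j + i` as a bijection onto `[j, ∞)`. -/
def shiftEquiv (j : ℕ) : ℕ ≃ Set.Ici j where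
  toFun i := ⟨j + i, Nat.le_add_right j i⟩
  invFun i := i - j
  left_inv i := by simp
  right_inv i := Subtype.ext (Nat.add_sub_of_le i.2)

theorem tsum_Ici_eq (f : ℕ → ℂ) (j : ℕ) : ∑' i : Set.Ici j, f i = ∑' i, f (j + i) :=
  ((shiftEquiv j).tsum_eq fun i : Set.Ici j => f i).symm

theorem summable_Ici_iff (f : ℕ → ℂ) (j : ℕ) :
    (Summable fun i : Set.Ici j => f i) ↔ Summable fun i => f (j + i) :=
  ((shiftEquiv j).summable_iff (f := fun i : Set.Ici j => f i)).symm

theorem summand_zero_eq {ρ h : ℝ} (α : ℝ) (η : ℂ) {k j : ℕ}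
    (hj : poch (deltaMinus ρ h k) j ≠ 0 ∧ poch (deltaPlus ρ h k) j ≠ 0) (i : ℕ) :
    summand ρ α h η 0 k j (j + i) =
      η ^ j * (pathProd (singleCoeff ρ h) (j + 2 * k) i * η ^ i) := by
  rw [summand, ratio_eq_pathProd hj.1 hj.2, pow_add]
  ring

theorem summand_succ_eq {ρ h : ℝ} (α : ℝ) (η : ℂ) {m k j : ℕ}
    (hm : ∀ i, ∑' i' : Set.Ici i, summand ρ α h η m (k + 1) i i' =
      η ^ i * levelSum (singleCoeff ρ h) (doubleCoeff α) η m (i + 2 * (k + 1)))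
    (hj : poch (deltaMinus ρ h k) j ≠ 0 ∧ poch (deltaPlus ρ h k) j ≠ 0) (i : ℕ) :
    summand ρ α h η (m + 1) k j (j + i) =
      η ^ j * (pathProd (singleCoeff ρ h) (j + 2 * k) i * η ^ i *
        (doubleCoeff α (j + 2 * k + i) *
          levelSum (singleCoeff ρ h) (doubleCoeff α) η m (j + 2 * k + i + 2))) := by
  rw [summand, hm, ratio_eq_pathProd hj.1 hj.2, weight_eq_doubleCoeff, pow_add,
    show j + i + 2 * k = j + 2 * k + i by ring,
    show j + i + 2 * (k + 1) = j + 2 * k + i + 2 by ring]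
  ring

/-- Nonvanishing is assumed only at the outermost level: the inner levels have `k + 1 ≥ 1`, where it
is automatic. -/
theorem tsum_summand_eq {ρ h : ℝ} (α : ℝ)
    (hh : ∀ m : ℕ, h ≠ 4 * (1 + ρ ^ 2) * ((m : ℝ) + 5 / 2) ^ 2) (η : ℂ) {k j : ℕ} (m : ℕ)
    (hj : poch (deltaMinus ρ h k) j ≠ 0 ∧ poch (deltaPlus ρ h k) j ≠ 0) :
    ∑' i : Set.Ici j, summand ρ α h η m k j i =
      η ^ j * levelSum (singleCoeff ρ h) (doubleCoeff α) η m (j + 2 * k) := by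
  induction m generalizing k j with
  | zero =>
    rw [tsum_Ici_eq (summand ρ α h η 0 k j), levelSum, ← tsum_mul_left]
    exact tsum_congr (summand_zero_eq α η hj)
  | succ m ih =>
    rw [tsum_Ici_eq (summand ρ α h η (m + 1) k j), levelSum, ← tsum_mul_left]
    exact tsum_congr (summand_succ_eq α η
      (fun i => ih (poch_delta_ne_zero hh (k + 1) i (by omega))) hj)

theorem summable_summand {ρ h : ℝ} (α : ℝ)
    (hh : ∀ m : ℕ, h ≠ 4 * (1 + ρ ^ 2) * ((m : ℝ) + 5 / 2) ^ 2) {η : ℂ} (hη : ‖η‖ < 1)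
    (m k j : ℕ) : Summable fun i : Set.Ici j => summand ρ α h η m k j i := by
  -- The individual nested sums do not involve `z`, so `z = 0` may be used and `‖η‖ < 1` suffices.
  obtain ⟨q, E, hE, -, hq⟩ := exists_majorizes_stretch (η := η) (z := 0)
    (tendsto_singleCoeff ρ h) (tendsto_doubleCoeff α) (by simpa using hη)
  rw [summable_Ici_iff (summand ρ α h η m k j)]
  by_cases hj : poch (deltaMinus ρ h k) j ≠ 0 ∧ poch (deltaPlus ρ h k) j ≠ 0
  · cases m with
    | zero => simpa only [summand_zero_eq α η hj] using (hE.summable_base hq _).mul_left _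
    | succ m =>
      simpa only [summand_succ_eq α η (fun i => tsum_summand_eq α hh η m
        (poch_delta_ne_zero hh (k + 1) i (by omega))) hj]
        using (hE.summable_step hq m _).mul_left _
  · have h0 : ∀ i, summand ρ α h η m k j i = 0 := by
      intro i
      cases m <;> simp [summand, ratio_eq_zero i hj]
    simpa only [h0] using summable_zero

theorem nested_eq_levelSum {ρ h : ℝ} (α : ℝ)
    (hh : ∀ m : ℕ, h ≠ 4 * (1 + ρ ^ 2) * ((m : ℝ) + 5 / 2) ^ 2) (η : ℂ) (n : ℕ) :
    nested ρ α h η n = levelSum (singleCoeff ρ h) (doubleCoeff α) η n 0 := by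
  rw [nested, tsum_summand_eq α hh η n (by simp [poch_zero])]
  simp

theorem summable_nested {ρ h : ℝ} (α : ℝ)
    (hh : ∀ m : ℕ, h ≠ 4 * (1 + ρ ^ 2) * ((m : ℝ) + 5 / 2) ^ 2) {ξ : ℂ} (hξ : ξ ∈ disc ρ) :
    Summable fun n : ℕ => nested ρ α h (eta ρ ξ) n * zeta ρ ξ ^ n := by
  obtain ⟨q, E, hE, hqz, hq⟩ := exists_majorizes_stretch
    (tendsto_singleCoeff ρ h) (tendsto_doubleCoeff α) hξ
  simpa only [nested_eq_levelSum α hh] using hE.summable_term hqz hq 0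

/-! ### Frobenius recurrence and Lamé's operator on partial sums -/

/-- The coefficients of the power series of `bracket` at `0`. -/
def seriesCoeff (ρ α h : ℝ) : ℕ → ℂ :=
  pathSeq (singleCoeff ρ h) (doubleCoeff α) (1 + (ρ : ℂ) ^ 2) (-(ρ : ℂ) ^ 2)

theorem pathSeq_eta_zeta (ρ α h : ℝ) (ξ : ℂ) (n : ℕ) :
    pathSeq (singleCoeff ρ h) (doubleCoeff α) (eta ρ ξ) (zeta ρ ξ) n =
      seriesCoeff ρ α h n * ξ ^ n :=
  pathSeq_mul ..

theorem hasSum_bracket {ρ h : ℝ} (α : ℝ)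
    (hh : ∀ m : ℕ, h ≠ 4 * (1 + ρ ^ 2) * ((m : ℝ) + 5 / 2) ^ 2) {ξ : ℂ} (hξ : ξ ∈ disc ρ) :
    HasSum (fun n => seriesCoeff ρ α h n * ξ ^ n) (bracket ρ α h ξ) := by
  simpa only [← pathSeq_eta_zeta, bracket, nested_eq_levelSum α hh] using
    hasSum_pathSeq (tendsto_singleCoeff ρ h) (tendsto_doubleCoeff α) hξ

theorem exists_norm_seriesCoeff_le (ρ α h : ℝ) {ξ : ℂ} (hξ : ξ ∈ disc ρ) :
    ∃ C θ : ℝ, 0 < θ ∧ θ < 1 ∧ ∀ n, ‖seriesCoeff ρ α h n * ξ ^ n‖ ≤ C * θ ^ n := by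
  simpa only [pathSeq_eta_zeta] using
    exists_norm_pathSeq_le (tendsto_singleCoeff ρ h) (tendsto_doubleCoeff α) hξ

/-- Lamé's operator on the factor `g` of `y = ξ^{1/2} g`, as an expression in `ξ` and the values of
`g''`, `g'` and `g`. -/
def lameOp (ρ α h : ℝ) (ξ g₂ g₁ g₀ : ℂ) : ℂ :=
  (ξ - (1 + (ρ : ℂ) ^ 2) * ξ ^ 2 + (ρ : ℂ) ^ 2 * ξ ^ 3) * g₂ +
    (3 / 2 - 2 * (1 + (ρ : ℂ) ^ 2) * ξ + 5 / 2 * (ρ : ℂ) ^ 2 * ξ ^ 2) * g₁ +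
    1 / 4 * (h - (1 + (ρ : ℂ) ^ 2) + (2 - α * (α + 1)) * (ρ : ℂ) ^ 2 * ξ) * g₀

theorem seriesCoeff_one (ρ α h : ℝ) :
    3 / 2 * seriesCoeff ρ α h 1 = 1 / 4 * (1 + (ρ : ℂ) ^ 2 - h) := by
  have h1 := one_add_sq_ne_zero ρ
  have h2 : singleCoeff ρ h 0 = (1 / 4 - root ρ h ^ 2) / (3 / 2) := by
    rw [singleCoeff]; push_cast; ring
  rw [seriesCoeff, pathSeq, h2, root_sq]
  field_simp

theorem seriesCoeff_add_two (ρ α h : ℝ) (n : ℕ) :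
    ((n : ℂ) + 2) * (n + 5 / 2) * seriesCoeff ρ α h (n + 2) =
      ((1 + (ρ : ℂ) ^ 2) * (n + 3 / 2) ^ 2 - h / 4) * seriesCoeff ρ α h (n + 1) -
        (ρ : ℂ) ^ 2 * (n + 1 / 2 - α / 2) * (n + 1 + α / 2) * seriesCoeff ρ α h n := by
  have h1 := one_add_sq_ne_zero ρ
  have h3 : (n : ℂ) + 2 ≠ 0 := by simpa using natCast_add_ne_zero (x := 2) (by norm_num) n
  have h4 : (n : ℂ) + 5 / 2 ≠ 0 := by
    simpa using natCast_add_ne_zero (x := 5 / 2) (by norm_num) n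
  have e1 : ((n : ℂ) + 2) * (n + 5 / 2) * singleCoeff ρ h (n + 1) =
      (n + 3 / 2) ^ 2 - root ρ h ^ 2 := by
    have : singleCoeff ρ h (n + 1) =
        ((n + 3 / 2) ^ 2 - root ρ h ^ 2) / (((n : ℂ) + 2) * (n + 5 / 2)) := by
      rw [singleCoeff]; push_cast; congr 1 <;> ring
    rw [this, mul_div_cancel₀ _ (mul_ne_zero h3 h4)]
  have e2 : ((n : ℂ) + 2) * (n + 5 / 2) * doubleCoeff α n =
      (n + 1 / 2 - α / 2) * (n + 1 + α / 2) := by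
    rw [doubleCoeff, mul_comm ((n : ℂ) + 2), mul_div_cancel₀ _ (mul_ne_zero h4 h3)]
    ring
  have e3 : (1 + (ρ : ℂ) ^ 2) * root ρ h ^ 2 = h / 4 := by
    rw [root_sq]; field_simp
  have hrec : seriesCoeff ρ α h (n + 2) =
      singleCoeff ρ h (n + 1) * (1 + (ρ : ℂ) ^ 2) * seriesCoeff ρ α h (n + 1) +
        doubleCoeff α n * (-(ρ : ℂ) ^ 2) * seriesCoeff ρ α h n := rfl
  rw [hrec]
  linear_combination (1 + (ρ : ℂ) ^ 2) * seriesCoeff ρ α h (n + 1) * e1 -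
    (ρ : ℂ) ^ 2 * seriesCoeff ρ α h n * e2 - seriesCoeff ρ α h (n + 1) * e3

/-- The partial sums of the power series of `bracket`. -/
def partialSum (ρ α h : ℝ) (n : ℕ) : Polynomial ℂ :=
  ∑ i ∈ range n, Polynomial.C (seriesCoeff ρ α h i) * Polynomial.X ^ i

theorem partialSum_succ (ρ α h : ℝ) (n : ℕ) :
    partialSum ρ α h (n + 1) =
      partialSum ρ α h n + Polynomial.C (seriesCoeff ρ α h n) * Polynomial.X ^ n :=
  sum_range_succ ..

open Polynomial in
-- By the recurrence the coefficients of all interior powers cancel; what remains is the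
-- contribution missing from the first omitted term and the top-degree contribution of the last one.
-- The extra factor `ξ` avoids the exponent `n - 1`.
theorem lameOp_partialSum (ρ α h : ℝ) (ξ : ℂ) (n : ℕ) :
    ξ * lameOp ρ α h ξ ((derivative (derivative (partialSum ρ α h (n + 1)))).eval ξ)
        ((derivative (partialSum ρ α h (n + 1))).eval ξ) ((partialSum ρ α h (n + 1)).eval ξ) =
      -(((n : ℂ) + 1) * (n + 3 / 2)) * (seriesCoeff ρ α h (n + 1) * ξ ^ (n + 1)) +
        (ρ : ℂ) ^ 2 * (n + 1 / 2 - α / 2) * (n + 1 + α / 2) * ξ ^ 2 *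
          (seriesCoeff ρ α h n * ξ ^ n) := by
  induction n with
  | zero =>
    have h0 : seriesCoeff ρ α h 0 = 1 := rfl
    simp only [partialSum, zero_add, range_one, sum_singleton, h0, pow_zero, map_one, mul_one,
      derivative_one, derivative_zero, eval_zero, eval_one, lameOp]
    push_cast
    linear_combination ξ * seriesCoeff_one ρ α h
  | succ n ih =>
    have hadd : ∀ a b c a' b' c' : ℂ, lameOp ρ α h ξ (a + a') (b + b') (c + c') =
        lameOp ρ α h ξ a b c + lameOp ρ α h ξ a' b' c' := by
      intros; simp only [lameOp]; ring
    have hpow : ξ * ((n : ℂ) * ξ ^ (n - 1)) = n * ξ ^ n := by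
      cases n with
      | zero => simp
      | succ n => rw [Nat.add_sub_cancel, pow_succ]; ring
    rw [partialSum_succ, derivative_add, derivative_add, eval_add, eval_add, eval_add, hadd,
      mul_add, ih]
    simp only [derivative_C_mul, derivative_X_pow, eval_mul, eval_C, eval_pow, eval_X,
      Nat.add_sub_cancel, lameOp]
    push_cast
    linear_combination (seriesCoeff ρ α h (n + 1)) * (n + 1) * ξ *
      (1 - (1 + (ρ : ℂ) ^ 2) * ξ + (ρ : ℂ) ^ 2 * ξ ^ 2) * hpow +
      ξ ^ (n + 2) * seriesCoeff_add_two ρ α h n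

/-! ### Convergence in the disc and the equation for the bracket -/

theorem norm_eta_add_norm_zeta (ρ : ℝ) (ξ : ℂ) :
    ‖eta ρ ξ‖ + ‖zeta ρ ξ‖ = (1 + ρ ^ 2) * ‖ξ‖ + ρ ^ 2 * ‖ξ‖ ^ 2 := by
  have h1 : ‖(1 + (ρ : ℂ) ^ 2)‖ = 1 + ρ ^ 2 := by
    have : (1 + (ρ : ℂ) ^ 2) = ((1 + ρ ^ 2 : ℝ) : ℂ) := by push_cast; rfl
    rw [this, Complex.norm_of_nonneg (by positivity)]
  rw [eta, zeta, norm_mul, norm_mul, h1, norm_neg, norm_pow, norm_pow, Complex.norm_real,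
    Real.norm_eq_abs, sq_abs]

theorem mem_disc_iff {ρ : ℝ} {ξ : ℂ} :
    ξ ∈ disc ρ ↔ (1 + ρ ^ 2) * ‖ξ‖ + ρ ^ 2 * ‖ξ‖ ^ 2 < 1 := by
  rw [disc, Set.mem_ofPred_eq, norm_eta_add_norm_zeta]

theorem isOpen_disc (ρ : ℝ) : IsOpen (disc ρ) := by
  simp only [disc, norm_eta_add_norm_zeta]
  exact isOpen_lt (by fun_prop) continuous_const

theorem mem_disc_of_norm_le {ρ : ℝ} {ξ w : ℂ} (hξ : ξ ∈ disc ρ) (hw : ‖w‖ ≤ ‖ξ‖) :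
    w ∈ disc ρ := by
  rw [mem_disc_iff] at hξ ⊢
  refine lt_of_le_of_lt ?_ hξ
  gcongr

theorem zero_mem_disc (ρ : ℝ) : (0 : ℂ) ∈ disc ρ := by
  simp [mem_disc_iff]

theorem norm_lt_one_of_mem_disc {ρ : ℝ} {ξ : ℂ} (hξ : ξ ∈ disc ρ) : ‖ξ‖ < 1 := by
  rw [mem_disc_iff] at hξ
  nlinarith [norm_nonneg ξ, sq_nonneg ρ, mul_nonneg (sq_nonneg ρ) (norm_nonneg ξ),
    mul_nonneg (sq_nonneg ρ) (sq_nonneg ‖ξ‖)]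

theorem exists_larger_mem_disc {ρ : ℝ} {ξ : ℂ} (hξ : ξ ∈ disc ρ) :
    ∃ b ∈ disc ρ, ‖ξ‖ < ‖b‖ := by
  rw [mem_disc_iff] at hξ
  have hc : Continuous fun r : ℝ => (1 + ρ ^ 2) * r + ρ ^ 2 * r ^ 2 := by fun_prop
  obtain ⟨r, hr, hr1⟩ := ((eventually_mem_nhdsWithin (a := ‖ξ‖) (s := Set.Ioi ‖ξ‖)).and
    (((hc.tendsto ‖ξ‖).mono_left nhdsWithin_le_nhds).eventually (gt_mem_nhds hξ))).exists
  have hn : ‖(r : ℂ)‖ = r := Complex.norm_of_nonneg ((norm_nonneg ξ).trans hr.le)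
  exact ⟨r, by rw [mem_disc_iff, hn]; exact hr1, by rw [hn]; exact hr⟩

/-- Weierstrass's M-test: the geometric bound at the single point `b` dominates every point of
smaller modulus. -/
theorem tendstoLocallyUniformlyOn_partialSum {ρ h : ℝ} (α : ℝ)
    (hh : ∀ m : ℕ, h ≠ 4 * (1 + ρ ^ 2) * ((m : ℝ) + 5 / 2) ^ 2) {b : ℂ} (hb : b ∈ disc ρ) :
    TendstoLocallyUniformlyOn (fun n ξ => (partialSum ρ α h n).eval ξ) (bracket ρ α h) atTop
      (Metric.ball 0 ‖b‖) := by
  obtain ⟨C, θ, hθ0, hθ1, hC⟩ := exists_norm_seriesCoeff_le ρ α h hb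
  have hu := (summable_geometric_of_lt_one hθ0.le hθ1).mul_left C
  have := (tendstoUniformlyOn_tsum_nat (f := fun n ξ => seriesCoeff ρ α h n * ξ ^ n) hu
    (s := Metric.ball 0 ‖b‖) fun n ξ hξ => by
      rw [mem_ball_zero_iff] at hξ
      refine le_trans ?_ (hC n)
      rw [norm_mul, norm_mul, norm_pow, norm_pow]
      gcongr)
  refine (this.congr_right fun ξ hξ => ?_).congr (.of_forall fun n ξ _ => ?_)
    |>.tendstoLocallyUniformlyOn
  · rw [mem_ball_zero_iff] at hξ
    exact (hasSum_bracket α hh (mem_disc_of_norm_le hb hξ.le)).tsum_eq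
  · simp [partialSum, Polynomial.eval_finsetSum]

theorem differentiableAt_bracket {ρ h : ℝ} (α : ℝ)
    (hh : ∀ m : ℕ, h ≠ 4 * (1 + ρ ^ 2) * ((m : ℝ) + 5 / 2) ^ 2) {ξ : ℂ} (hξ : ξ ∈ disc ρ) :
    DifferentiableAt ℂ (bracket ρ α h) ξ := by
  obtain ⟨b, hb, hlt⟩ := exists_larger_mem_disc hξ
  exact ((tendstoLocallyUniformlyOn_partialSum α hh hb).differentiableOn
    (.of_forall fun n => (partialSum ρ α h n).differentiable.differentiableOn)
    Metric.isOpen_ball).differentiableAt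
      (Metric.isOpen_ball.mem_nhds (mem_ball_zero_iff.2 hlt))

theorem bracket_zero {ρ h : ℝ} (α : ℝ)
    (hh : ∀ m : ℕ, h ≠ 4 * (1 + ρ ^ 2) * ((m : ℝ) + 5 / 2) ^ 2) : bracket ρ α h 0 = 1 := by
  refine (hasSum_bracket α hh (zero_mem_disc ρ)).unique ?_
  have : seriesCoeff ρ α h 0 * 0 ^ 0 = 1 := by
    rw [pow_zero, mul_one]; rfl
  rw [← this]
  exact hasSum_single 0 fun n hn => by rw [zero_pow hn, mul_zero]

/-- Locally uniform convergence passes to the first two derivatives, so the identity for partial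
sums can be taken to the limit. Its right side is a polynomial in `n` times geometrically decaying
terms. -/
theorem lameOp_bracket {ρ h : ℝ} (α : ℝ)
    (hh : ∀ m : ℕ, h ≠ 4 * (1 + ρ ^ 2) * ((m : ℝ) + 5 / 2) ^ 2) {ξ : ℂ} (hξ : ξ ∈ disc ρ)
    (h0 : ξ ≠ 0) :
    lameOp ρ α h ξ (deriv (deriv (bracket ρ α h)) ξ) (deriv (bracket ρ α h) ξ)
      (bracket ρ α h ξ) = 0 := by
  obtain ⟨b, hb, hlt⟩ := exists_larger_mem_disc hξ
  have hmem : ξ ∈ Metric.ball (0 : ℂ) ‖b‖ := mem_ball_zero_iff.2 hlt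
  have t0 := tendstoLocallyUniformlyOn_partialSum α hh hb
  have t1 := t0.deriv (.of_forall fun n => (partialSum ρ α h n).differentiable.differentiableOn)
    Metric.isOpen_ball
  have hd : (deriv ∘ fun n ξ => (partialSum ρ α h n).eval ξ) =
      fun n ξ => (Polynomial.derivative (partialSum ρ α h n)).eval ξ := by
    funext n x; simp
  rw [hd] at t1
  have t2 := t1.deriv (.of_forall fun n =>
    (Polynomial.derivative (partialSum ρ α h n)).differentiable.differentiableOn)
    Metric.isOpen_ball
  have hd : (deriv ∘ fun n ξ => (Polynomial.derivative (partialSum ρ α h n)).eval ξ) =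
      fun n ξ => (Polynomial.derivative (Polynomial.derivative (partialSum ρ α h n))).eval ξ := by
    funext n x; simp
  rw [hd] at t2
  have p0 := (t0.tendsto_at hmem).comp (tendsto_add_atTop_nat 1)
  have p1 := (t1.tendsto_at hmem).comp (tendsto_add_atTop_nat 1)
  have p2 := (t2.tendsto_at hmem).comp (tendsto_add_atTop_nat 1)
  have hlim := ((((p2.const_mul (ξ - (1 + (ρ : ℂ) ^ 2) * ξ ^ 2 + (ρ : ℂ) ^ 2 * ξ ^ 3)).add
    (p1.const_mul (3 / 2 - 2 * (1 + (ρ : ℂ) ^ 2) * ξ + 5 / 2 * (ρ : ℂ) ^ 2 * ξ ^ 2))).add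
    (p0.const_mul (1 / 4 * (h - (1 + (ρ : ℂ) ^ 2) +
      (2 - α * (α + 1)) * (ρ : ℂ) ^ 2 * ξ)))).const_mul ξ).congr (lameOp_partialSum ρ α h ξ)
  obtain ⟨C, θ, hθ0, hθ1, hC⟩ := exists_norm_seriesCoeff_le ρ α h hξ
  have hdecay : ∀ k : ℕ, Tendsto (fun n : ℕ => (n : ℂ) ^ k * (seriesCoeff ρ α h n * ξ ^ n))
      atTop (𝓝 0) := by
    intro k
    have := (tendsto_pow_const_mul_const_pow_of_lt_one k hθ0.le hθ1).const_mul C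
    rw [mul_zero] at this
    refine squeeze_zero_norm (fun n => ?_) this
    rw [norm_mul, norm_pow, Complex.norm_natCast]
    calc (n : ℝ) ^ k * ‖seriesCoeff ρ α h n * ξ ^ n‖ ≤ (n : ℝ) ^ k * (C * θ ^ n) := by
          gcongr; exact hC n
      _ = _ := by ring
  have hrem : Tendsto (fun n : ℕ =>
      -(((n : ℂ) + 1) * (n + 3 / 2)) * (seriesCoeff ρ α h (n + 1) * ξ ^ (n + 1)) +
        (ρ : ℂ) ^ 2 * (n + 1 / 2 - α / 2) * (n + 1 + α / 2) * ξ ^ 2 *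
          (seriesCoeff ρ α h n * ξ ^ n)) atTop (𝓝 0) := by
    have l1 := ((hdecay 2).add ((hdecay 1).const_mul (1 / 2))).comp (tendsto_add_atTop_nat 1)
    have l2 := (((hdecay 2).add ((hdecay 1).const_mul (3 / 2))).add
      ((hdecay 0).const_mul ((1 / 2 - (α : ℂ) / 2) * (1 + α / 2)))).const_mul
        ((ρ : ℂ) ^ 2 * ξ ^ 2)
    have l := l1.neg.add l2
    simp only [mul_zero, add_zero, neg_zero] at l
    refine l.congr fun n => ?_
    simp only [Function.comp_apply]
    push_cast
    ring
  exact (mul_eq_zero.1 (tendsto_nhds_unique hlim hrem)).resolve_left h0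

/-! ### Lamé's equation in `ξ` -/

/-- The square root in `LS` has the derivative `ξ^{1/2} / (2 ξ)`. -/
theorem hasDerivAt_sqrt {ξ : ℂ} (hξ : ξ ∈ Complex.slitPlane) :
    HasDerivAt (fun w : ℂ => w ^ (1 / 2 : ℂ)) (ξ ^ (1 / 2 : ℂ) / (2 * ξ)) ξ := by
  have h0 : ξ ≠ 0 := Complex.slitPlane_ne_zero hξ
  refine ((hasDerivAt_id ξ).cpow_const (c := 1 / 2) hξ).congr_deriv ?_
  rw [id, Complex.cpow_sub _ _ h0, Complex.cpow_one]
  field_simp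

theorem analyticAt_bracket {ρ h : ℝ} (α : ℝ)
    (hh : ∀ m : ℕ, h ≠ 4 * (1 + ρ ^ 2) * ((m : ℝ) + 5 / 2) ^ 2) {ξ : ℂ} (hξ : ξ ∈ disc ρ) :
    AnalyticAt ℂ (bracket ρ α h) ξ :=
  DifferentiableOn.analyticAt (s := disc ρ)
    (fun _ hw => (differentiableAt_bracket α hh hw).differentiableWithinAt)
    ((isOpen_disc ρ).mem_nhds hξ)

theorem isOpen_domain (ρ : ℝ) : IsOpen (disc ρ ∩ Complex.slitPlane) :=
  (isOpen_disc ρ).inter Complex.isOpen_slitPlane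

theorem hasDerivAt_LS {ρ h : ℝ} (α : ℝ)
    (hh : ∀ m : ℕ, h ≠ 4 * (1 + ρ ^ 2) * ((m : ℝ) + 5 / 2) ^ 2) {ξ : ℂ}
    (hξ : ξ ∈ disc ρ ∩ Complex.slitPlane) :
    HasDerivAt (LS ρ α h)
      (ξ ^ (1 / 2 : ℂ) * (bracket ρ α h ξ / (2 * ξ) + deriv (bracket ρ α h) ξ)) ξ := by
  refine ((hasDerivAt_sqrt hξ.2).mul
    (differentiableAt_bracket α hh hξ.1).hasDerivAt).congr_deriv ?_
  ring

theorem hasDerivAt_deriv_LS {ρ h : ℝ} (α : ℝ)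
    (hh : ∀ m : ℕ, h ≠ 4 * (1 + ρ ^ 2) * ((m : ℝ) + 5 / 2) ^ 2) {ξ : ℂ}
    (hξ : ξ ∈ disc ρ ∩ Complex.slitPlane) :
    HasDerivAt (deriv (LS ρ α h))
      (ξ ^ (1 / 2 : ℂ) * (-bracket ρ α h ξ / (4 * ξ ^ 2) + deriv (bracket ρ α h) ξ / ξ +
        deriv (deriv (bracket ρ α h)) ξ)) ξ := by
  have h0 : ξ ≠ 0 := Complex.slitPlane_ne_zero hξ.2
  have hg := (differentiableAt_bracket α hh hξ.1).hasDerivAt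
  have hg' := (analyticAt_bracket α hh hξ.1).deriv.differentiableAt.hasDerivAt
  have hlin : HasDerivAt (fun w : ℂ => 2 * w) 2 ξ := by
    simpa using (hasDerivAt_id ξ).const_mul (2 : ℂ)
  have := (hasDerivAt_sqrt hξ.2).mul
    ((hg.div hlin (mul_ne_zero two_ne_zero h0)).add hg')
  refine (this.congr_of_eventuallyEq ?_).congr_deriv ?_
  · filter_upwards [(isOpen_domain ρ).mem_nhds hξ] with w hw
    exact (hasDerivAt_LS α hh hw).deriv
  · simp only [Pi.add_apply, Pi.div_apply]
    field_simp
    ring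

theorem ne_inv_sq_of_mem_disc {ρ : ℝ} (hρ0 : 0 < ρ) (hρ1 : ρ < 1) {ξ : ℂ} (hξ : ξ ∈ disc ρ) :
    (ρ : ℂ) ^ 2 * ξ ≠ 1 := by
  intro h0
  have h1 := congrArg norm h0
  rw [norm_mul, norm_pow, Complex.norm_real, Real.norm_eq_abs, sq_abs, norm_one] at h1
  have h2 := norm_lt_one_of_mem_disc hξ
  have h3 : ρ ^ 2 < 1 := by nlinarith
  nlinarith [norm_nonneg ξ, sq_nonneg ρ]

/-- Lamé's equation cleared of denominators. -/
theorem lame_equation_cleared {ρ h : ℝ} (α : ℝ)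
    (hh : ∀ m : ℕ, h ≠ 4 * (1 + ρ ^ 2) * ((m : ℝ) + 5 / 2) ^ 2) {ξ : ℂ}
    (hξ : ξ ∈ disc ρ ∩ Complex.slitPlane) :
    4 * ξ * (1 - ξ) * (1 - (ρ : ℂ) ^ 2 * ξ) * deriv (deriv (LS ρ α h)) ξ +
      (2 - 4 * (1 + (ρ : ℂ) ^ 2) * ξ + 6 * (ρ : ℂ) ^ 2 * ξ ^ 2) * deriv (LS ρ α h) ξ +
      (h - α * (α + 1) * (ρ : ℂ) ^ 2 * ξ) * LS ρ α h ξ = 0 := by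
  have h0 : ξ ≠ 0 := Complex.slitPlane_ne_zero hξ.2
  have hg := lameOp_bracket α hh hξ.1 h0
  rw [(hasDerivAt_deriv_LS α hh hξ).deriv, (hasDerivAt_LS α hh hξ).deriv, LS]
  rw [lameOp] at hg
  field_simp
  linear_combination 8 * ξ * ξ ^ (1 / 2 : ℂ) * hg

theorem lame_equation {ρ h : ℝ} (α : ℝ) (hρ0 : 0 < ρ) (hρ1 : ρ < 1)
    (hh : ∀ m : ℕ, h ≠ 4 * (1 + ρ ^ 2) * ((m : ℝ) + 5 / 2) ^ 2) {ξ : ℂ}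
    (hξ : ξ ∈ disc ρ ∩ Complex.slitPlane) :
    deriv (deriv (LS ρ α h)) ξ +
        1 / 2 * (1 / ξ + 1 / (ξ - 1) + 1 / (ξ - ((ρ : ℂ) ^ 2)⁻¹)) * deriv (LS ρ α h) ξ +
        (-(α : ℂ) * ((α : ℂ) + 1) * ξ + (h : ℂ) * ((ρ : ℂ) ^ 2)⁻¹) /
            (4 * ξ * (ξ - 1) * (ξ - ((ρ : ℂ) ^ 2)⁻¹)) * LS ρ α h ξ = 0 := by
  have h0 : ξ ≠ 0 := Complex.slitPlane_ne_zero hξ.2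
  have h1 : ξ - 1 ≠ 0 := by
    intro h
    have := norm_lt_one_of_mem_disc hξ.1
    rw [sub_eq_zero.1 h, norm_one] at this
    exact lt_irrefl _ this
  have hρ : (ρ : ℂ) ≠ 0 := by exact_mod_cast hρ0.ne'
  have h2 : (ρ : ℂ) ^ 2 * ξ - 1 ≠ 0 := sub_ne_zero.2 (ne_inv_sq_of_mem_disc hρ0 hρ1 hξ.1)
  have h3 : ξ - ((ρ : ℂ) ^ 2)⁻¹ = ((ρ : ℂ) ^ 2 * ξ - 1) / (ρ : ℂ) ^ 2 := by field_simp
  have key := lame_equation_cleared α hh hξ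
  rw [h3]
  -- The factor `ρ²ξ - 1` is made an atom, known to be nonzero, while denominators are cleared.
  obtain ⟨d, hd⟩ : ∃ d, d = (ρ : ℂ) ^ 2 * ξ - 1 := ⟨_, rfl⟩
  rw [← hd] at h2 ⊢
  field_simp
  rw [hd]
  linear_combination 2 * key

/-! ### The amplitude and the derivatives of `sn²` -/

section Amplitude

variable {ρ : ℝ}

theorem one_sub_sq_mul_sin_sq_pos (hρ0 : 0 < ρ) (hρ1 : ρ < 1) (θ : ℝ) :
    0 < 1 - ρ ^ 2 * Real.sin θ ^ 2 := by
  have h1 : ρ ^ 2 < 1 := by nlinarith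
  nlinarith [Real.sin_sq_le_one θ, sq_nonneg (Real.sin θ), sq_nonneg ρ]

theorem continuous_integrand (hρ0 : 0 < ρ) (hρ1 : ρ < 1) :
    Continuous fun θ : ℝ => 1 / √(1 - ρ ^ 2 * Real.sin θ ^ 2) :=
  continuous_const.div (by fun_prop)
    fun θ => (Real.sqrt_pos.2 (one_sub_sq_mul_sin_sq_pos hρ0 hρ1 θ)).ne'

theorem hasDerivAt_ellipticF (hρ0 : 0 < ρ) (hρ1 : ρ < 1) (φ : ℝ) :
    HasDerivAt (ellipticF ρ) (1 / √(1 - ρ ^ 2 * Real.sin φ ^ 2)) φ :=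
  (continuous_integrand hρ0 hρ1).integral_hasStrictDerivAt 0 φ |>.hasDerivAt

theorem one_le_integrand (hρ0 : 0 < ρ) (hρ1 : ρ < 1) (φ : ℝ) :
    1 ≤ 1 / √(1 - ρ ^ 2 * Real.sin φ ^ 2) := by
  have h := one_sub_sq_mul_sin_sq_pos hρ0 hρ1 φ
  rw [le_div_iff₀ (Real.sqrt_pos.2 h), one_mul, Real.sqrt_le_one]
  nlinarith [mul_nonneg (sq_nonneg ρ) (sq_nonneg (Real.sin φ))]

/-- The integrand is at least `1`. Growth at least as fast as the identity gives both strict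
monotonicity and surjectivity of `ellipticF`, hence a genuine inverse. -/
theorem monotone_ellipticF_sub (hρ0 : 0 < ρ) (hρ1 : ρ < 1) :
    Monotone fun φ => ellipticF ρ φ - φ := by
  have hd : ∀ φ, HasDerivAt (fun φ => ellipticF ρ φ - φ)
      (1 / √(1 - ρ ^ 2 * Real.sin φ ^ 2) - 1) φ :=
    fun φ => (hasDerivAt_ellipticF hρ0 hρ1 φ).sub (hasDerivAt_id φ)
  refine monotone_of_deriv_nonneg (fun φ => (hd φ).differentiableAt) fun φ => ?_
  rw [(hd φ).deriv]
  linarith [one_le_integrand hρ0 hρ1 φ]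

theorem strictMono_ellipticF (hρ0 : 0 < ρ) (hρ1 : ρ < 1) : StrictMono (ellipticF ρ) := by
  intro a b hab
  have := monotone_ellipticF_sub hρ0 hρ1 hab.le
  simp only at this
  linarith

theorem surjective_ellipticF (hρ0 : 0 < ρ) (hρ1 : ρ < 1) :
    Function.Surjective (ellipticF ρ) := by
  have hc : Continuous (ellipticF ρ) :=
    continuous_iff_continuousAt.2 fun φ => (hasDerivAt_ellipticF hρ0 hρ1 φ).continuousAt
  have h0 : ellipticF ρ 0 = 0 := by simp [ellipticF]
  have hm := monotone_ellipticF_sub hρ0 hρ1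
  refine hc.surjective (tendsto_atTop_mono' _ ?_ tendsto_id)
    (tendsto_atBot_mono' _ ?_ tendsto_id)
  · filter_upwards [eventually_ge_atTop 0] with φ hφ
    have := hm hφ
    simp only [h0] at this
    simp only [id]; linarith
  · filter_upwards [eventually_le_atBot 0] with φ hφ
    have := hm hφ
    simp only [h0] at this
    simp only [id]; linarith

theorem ellipticF_am (hρ0 : 0 < ρ) (hρ1 : ρ < 1) (u : ℝ) : ellipticF ρ (am ρ u) = u :=
  Function.rightInverse_invFun (surjective_ellipticF hρ0 hρ1) u

theorem continuous_am (hρ0 : 0 < ρ) (hρ1 : ρ < 1) : Continuous (am ρ) := by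
  set e := StrictMono.orderIsoOfSurjective _ (strictMono_ellipticF hρ0 hρ1)
    (surjective_ellipticF hρ0 hρ1) with he
  have : am ρ = e.symm := by
    funext u
    apply (strictMono_ellipticF hρ0 hρ1).injective
    rw [ellipticF_am hρ0 hρ1]
    exact (e.apply_symm_apply u).symm
  rw [this]
  exact e.symm.continuous

theorem hasDerivAt_am (hρ0 : 0 < ρ) (hρ1 : ρ < 1) (u : ℝ) :
    HasDerivAt (am ρ) (√(1 - ρ ^ 2 * Real.sin (am ρ u) ^ 2)) u := by
  have := HasDerivAt.of_local_left_inverse (continuous_am hρ0 hρ1).continuousAt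
    (hasDerivAt_ellipticF hρ0 hρ1 (am ρ u))
    (zero_lt_one.trans_le (one_le_integrand hρ0 hρ1 _)).ne'
    (.of_forall (ellipticF_am hρ0 hρ1))
  simpa using this

/-- The derivative `2 sn cn dn` of `sn²`. -/
def snSqDeriv (ρ u : ℝ) : ℝ :=
  2 * Real.sin (am ρ u) * Real.cos (am ρ u) * √(1 - ρ ^ 2 * Real.sin (am ρ u) ^ 2)

theorem hasDerivAt_sn_sq (hρ0 : 0 < ρ) (hρ1 : ρ < 1) (u : ℝ) :
    HasDerivAt (fun v => sn ρ v ^ 2) (snSqDeriv ρ u) u := by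
  refine ((hasDerivAt_am hρ0 hρ1 u).sin.pow 2).congr_deriv ?_
  rw [snSqDeriv]
  ring

theorem snSqDeriv_sq (hρ0 : 0 < ρ) (hρ1 : ρ < 1) (u : ℝ) :
    snSqDeriv ρ u ^ 2 = 4 * sn ρ u ^ 2 * (1 - sn ρ u ^ 2) * (1 - ρ ^ 2 * sn ρ u ^ 2) := by
  rw [snSqDeriv, mul_pow, mul_pow, mul_pow,
    Real.sq_sqrt (one_sub_sq_mul_sin_sq_pos hρ0 hρ1 _).le, Real.cos_sq', sn]
  ring

/-- Direct differentiation of `2 sn cn dn`, rather than of the formula for its square, avoids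
dividing by it where it vanishes. -/
theorem hasDerivAt_snSqDeriv (hρ0 : 0 < ρ) (hρ1 : ρ < 1) (u : ℝ) :
    HasDerivAt (snSqDeriv ρ)
      (2 - 4 * (1 + ρ ^ 2) * sn ρ u ^ 2 + 6 * ρ ^ 2 * (sn ρ u ^ 2) ^ 2) u := by
  have hpos := one_sub_sq_mul_sin_sq_pos hρ0 hρ1 (am ρ u)
  have ha := hasDerivAt_am hρ0 hρ1 u
  have hs := hasDerivAt_sn_sq hρ0 hρ1 u
  have hd := ((hs.const_mul (ρ ^ 2)).const_sub 1).sqrt hpos.ne'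
  refine (((ha.sin.const_mul 2).mul ha.cos).mul hd).congr_deriv ?_
  have hsq := Real.sq_sqrt hpos.le
  have hne := (Real.sqrt_pos.2 hpos).ne'
  have hc := Real.cos_sq' (am ρ u)
  simp only [sn, snSqDeriv, Pi.mul_apply] at *
  generalize √(1 - ρ ^ 2 * Real.sin (am ρ u) ^ 2) = d at *
  generalize Real.sin (am ρ u) = s at *
  generalize Real.cos (am ρ u) = c at *
  have e : (2 * (c * d) * c + 2 * s * (-s * d)) * d +
      2 * s * c * (-(ρ ^ 2 * (2 * s * c * d)) / (2 * d)) =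
      2 * c ^ 2 * d ^ 2 - 2 * s ^ 2 * d ^ 2 - 2 * ρ ^ 2 * s ^ 2 * c ^ 2 := by
    field_simp
    ring
  rw [e, hc, hsq]
  ring

end Amplitude

/-! ### Weierstrass's form by `ξ = sn²` -/

section Substitution

variable {ρ h : ℝ}

theorem sn_sq_mem_domain {u : ℝ} (h0 : sn ρ u ≠ 0) (hu : ((sn ρ u : ℂ) ^ 2) ∈ disc ρ) :
    (((sn ρ u ^ 2 : ℝ) : ℂ)) ∈ disc ρ ∩ Complex.slitPlane := by
  refine ⟨by push_cast; exact hu, ?_⟩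
  rw [Complex.ofReal_mem_slitPlane]
  positivity

theorem hasDerivAt_LS_sn_sq (α : ℝ) (hρ0 : 0 < ρ) (hρ1 : ρ < 1)
    (hh : ∀ m : ℕ, h ≠ 4 * (1 + ρ ^ 2) * ((m : ℝ) + 5 / 2) ^ 2) {u : ℝ}
    (hu : (((sn ρ u ^ 2 : ℝ) : ℂ)) ∈ disc ρ ∩ Complex.slitPlane) :
    HasDerivAt (fun v : ℝ => LS ρ α h ((sn ρ v ^ 2 : ℝ) : ℂ))
      (deriv (LS ρ α h) ((sn ρ u ^ 2 : ℝ) : ℂ) * (snSqDeriv ρ u : ℂ)) u := by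
  have h1 := (hasDerivAt_LS α hh hu).differentiableAt.hasDerivAt
  exact h1.comp u (hasDerivAt_sn_sq hρ0 hρ1 u).ofReal_comp

theorem hasDerivAt_deriv_LS_sn_sq (α : ℝ) (hρ0 : 0 < ρ) (hρ1 : ρ < 1)
    (hh : ∀ m : ℕ, h ≠ 4 * (1 + ρ ^ 2) * ((m : ℝ) + 5 / 2) ^ 2) {u : ℝ}
    (hu : (((sn ρ u ^ 2 : ℝ) : ℂ)) ∈ disc ρ ∩ Complex.slitPlane) :
    HasDerivAt (deriv fun v : ℝ => LS ρ α h ((sn ρ v ^ 2 : ℝ) : ℂ))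
      (((α : ℂ) * ((α : ℂ) + 1) * (ρ : ℂ) ^ 2 * ((sn ρ u ^ 2 : ℝ) : ℂ) - (h : ℂ)) *
        LS ρ α h ((sn ρ u ^ 2 : ℝ) : ℂ)) u := by
  have hs := hasDerivAt_sn_sq hρ0 hρ1 u
  have h2 := (hasDerivAt_deriv_LS α hh hu).differentiableAt.hasDerivAt
  have hcomp := h2.comp u hs.ofReal_comp
  have hprod := hcomp.mul (hasDerivAt_snSqDeriv hρ0 hρ1 u).ofReal_comp
  refine (hprod.congr_of_eventuallyEq ?_).congr_deriv ?_
  · have hc : ContinuousAt (fun v => ((sn ρ v ^ 2 : ℝ) : ℂ)) u := hs.ofReal_comp.continuousAt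
    filter_upwards [hc.preimage_mem_nhds ((isOpen_domain ρ).mem_nhds hu)] with v hv
    exact (hasDerivAt_LS_sn_sq α hρ0 hρ1 hh hv).deriv
  · have key := lame_equation_cleared α hh hu
    have hsq : ((snSqDeriv ρ u : ℂ)) ^ 2 = 4 * ((sn ρ u ^ 2 : ℝ) : ℂ) *
        (1 - ((sn ρ u ^ 2 : ℝ) : ℂ)) * (1 - (ρ : ℂ) ^ 2 * ((sn ρ u ^ 2 : ℝ) : ℂ)) := by
      exact_mod_cast snSqDeriv_sq hρ0 hρ1 u
    simp only [Function.comp_apply]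
    generalize hx : sn ρ u ^ 2 = x at *
    push_cast
    -- By the chain rule the second derivative is `y'' x'² + y' x''`. The `x''` term already matches
    -- the cleared equation, and `hsq` converts `x'²` into the coefficient of `y''`.
    linear_combination key + deriv (deriv (LS ρ α h)) (x : ℂ) * hsq

end Substitution

end Lame

end

theorem mainTheorem4 (ρ α h : ℝ) (hρ0 : 0 < ρ) (hρ1 : ρ < 1)
    (hh : ∀ m : ℕ, h ≠ 4 * (1 + ρ ^ 2) * ((m : ℝ) + 5 / 2) ^ 2) :
    -- no denominator of the nested series vanishes
    (∀ k i : ℕ, 1 ≤ k →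
      Lame.poch (Lame.deltaMinus ρ h k) i ≠ 0 ∧ Lame.poch (Lame.deltaPlus ρ h k) i ≠ 0) ∧
    -- all sums of the nested series converge
    (∀ ξ ∈ Lame.disc ρ,
      (∀ m k j : ℕ,
        Summable fun i : Set.Ici j => Lame.summand ρ α h (Lame.eta ρ ξ) m k j i) ∧
      Summable fun n : ℕ =>
        Lame.nested ρ α h (Lame.eta ρ ξ) n * Lame.zeta ρ ξ ^ n) ∧
    -- the exponent at `ξ = 0` is `1/2`, with leading coefficient `1`
    DifferentiableOn ℂ (Lame.bracket ρ α h) (Lame.disc ρ) ∧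
    Lame.bracket ρ α h 0 = 1 ∧
    -- the equation in the variable `ξ`
    DifferentiableOn ℂ (Lame.LS ρ α h) (Lame.disc ρ ∩ Complex.slitPlane) ∧
    (∀ ξ ∈ Lame.disc ρ ∩ Complex.slitPlane,
      deriv (deriv (Lame.LS ρ α h)) ξ +
        1 / 2 * (1 / ξ + 1 / (ξ - 1) + 1 / (ξ - ((ρ : ℂ) ^ 2)⁻¹)) *
          deriv (Lame.LS ρ α h) ξ +
        (-(α : ℂ) * ((α : ℂ) + 1) * ξ + (h : ℂ) * ((ρ : ℂ) ^ 2)⁻¹) /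
            (4 * ξ * (ξ - 1) * (ξ - ((ρ : ℂ) ^ 2)⁻¹)) *
          Lame.LS ρ α h ξ = 0) ∧
    -- the equation in the variable `u`, where `ξ = sn²(u, ρ)`
    (∀ u : ℝ, Lame.sn ρ u ≠ 0 → ((Lame.sn ρ u : ℂ) ^ 2) ∈ Lame.disc ρ →
      DifferentiableAt ℝ (fun v : ℝ => Lame.LS ρ α h ((Lame.sn ρ v : ℂ) ^ 2)) u ∧
      DifferentiableAt ℝ
        (deriv fun v : ℝ => Lame.LS ρ α h ((Lame.sn ρ v : ℂ) ^ 2)) u ∧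
      deriv (deriv fun v : ℝ => Lame.LS ρ α h ((Lame.sn ρ v : ℂ) ^ 2)) u =
        ((α : ℂ) * ((α : ℂ) + 1) * (ρ : ℂ) ^ 2 * (Lame.sn ρ u : ℂ) ^ 2 - (h : ℂ)) *
          Lame.LS ρ α h ((Lame.sn ρ u : ℂ) ^ 2)) := by
  refine ⟨Lame.poch_delta_ne_zero hh, fun ξ hξ => ⟨fun m k j => ?_, Lame.summable_nested α hh hξ⟩,
    fun ξ hξ => (Lame.differentiableAt_bracket α hh hξ).differentiableWithinAt,
    Lame.bracket_zero α hh,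
    fun ξ hξ => (Lame.hasDerivAt_LS α hh hξ).differentiableAt.differentiableWithinAt,
    fun ξ hξ => Lame.lame_equation α hρ0 hρ1 hh hξ, fun u h0 hu => ?_⟩
  · exact Lame.summable_summand α hh
      ((le_add_of_nonneg_right (norm_nonneg _)).trans_lt (Set.mem_ofPred_eq ▸ hξ)) m k j
  · have hmem := Lame.sn_sq_mem_domain h0 hu
    have h1 := Lame.hasDerivAt_LS_sn_sq α hρ0 hρ1 hh hmem
    have h2 := Lame.hasDerivAt_deriv_LS_sn_sq α hρ0 hρ1 hh hmem
    simp only [Complex.ofReal_pow] at h1 h2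
    exact ⟨h1.differentiableAt, h2.differentiableAt, h2.deriv⟩
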